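/- For a positive integer $\ell$ (the superbity) let $$\mathcal A_\ell=\prod_{p}(\mathbb Z/p^\ell\mathbb Z)\Big/\bigoplus_{p}(\mathbb Z/p^\ell\mathbb Z),$$ where $p$ runs over all primes; two families $(a_p)_p$, $(b_p)_p$ define the same element if and only if $a_p=b_p$ for all but finitely many $p$. Rational numbers $r$ are regarded as elements of $\mathcal A_\ell$ via $r\mapsto (r \bmod p^\ell)_p$, where the component is set to $0$ at the finitely many primes $p$ dividing the denominator of $r$. For $\mathbf s=(s_1,\dots,s_d)$ with positive integers $s_j$ (of depth $d$ and weight $s_1+\dots+s_d$) define the finite multiple zeta value (FMZV) of superbity $\ell$ and its star version by $$\zeta_{\mathcal A_\ell}(\mathbf s)=\Big(\sum_{p>k_1>\dots>k_d\ge 1}\frac1{k_1^{s_1}\cdots k_d^{s_d}}\bmod p^\ell\Big)_p,\qquad \zeta^\star_{\mathcal A_\ell}(\mathbf s)=\Big(\sum_{p>k_1\ge\dots\ge k_d\ge 1}\frac1{k_1^{s_1}\cdots k_d^{s_d}}\bmod p^\ell\Big)_p .$$ Let $B_n$ be the Bernoulli numbers and let $\mathfrak b_3=\big(\tfrac{B_{p-3}}{3}\bmod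 p\big)_{p>3}\in\mathcal A_1$ (with component $0$ at $p\le 3$). **Theorem.** Every FMZV of superbity $1$, depth $3$ and weight $6$ is a rational multiple of $\mathfrak b_3^2$. Explicitly, $$\begin{aligned} &\zeta_{\mathcal A_1}(1,3,2)=-\tfrac92\mathfrak b_3^2, && \zeta_{\mathcal A_1}(1,4,1)=3\mathfrak b_3^2, && \zeta_{\mathcal A_1}(1,1,4)=-\tfrac32\mathfrak b_3^2,\\ &\zeta_{\mathcal A_1}(2,1,3)=\tfrac32\mathfrak b_3^2, && \zeta_{\mathcal A_1}(2,3,1)=-\tfrac92\mathfrak b_3^2, && \zeta_{\mathcal A_1}(3,1,2)=\tfrac32\mathfrak b_3^2,\\ &\zeta_{\mathcal A_1}(3,2,1)=3\mathfrak b_3^2, && \zeta_{\mathcal A_1}(4,1,1)=-\tfrac32\mathfrak b_3^2, && \zeta_{\mathcal A_1}(1,2,3)=3\mathfrak b_3^2, \end{aligned}$$ and $\zeta_{\mathcal A_1}(2,2,2)=0$. Moreover, for each of these $\mathbf s$ (depth $3$, weight $6$), $\zeta^\star_{\mathcal A_1}(\mathbf s)=-\zeta_{\mathcal A_1}(\mathbf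 s)$ if the weight and the depth have the same parity, and $\zeta^\star_{\mathcal A_1}(\mathbf s)=\zeta_{\mathcal A_1}(\mathbf s)$ otherwise; since $6$ and $3$ have different parity, this says that $\zeta^\star_{\mathcal A_1}(\mathbf s)=\zeta_{\mathcal A_1}(\mathbf s)$ for all of them. -/

import Mathlib

/-- The families `(a_p)_p`, `a_p ∈ ℤ/p^ℓ`, indexed by the primes, with `a_p = 0` for all but finitely
many `p`: the direct sum `⨁_p ℤ/p^ℓ` as an ideal of the product `∏_p ℤ/p^ℓ`. -/
def finiteSupportIdeal (ℓ : ℕ) : Ideal (∀ p : Nat.Primes, ZMod ((p : ℕ) ^ ℓ)) where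
  carrier := {a | {p | a p ≠ 0}.Finite}
  zero_mem' := by simp
  add_mem' := by
    intro a b ha hb
    refine (Set.Finite.union ha hb).subset ?_
    intro p hp
    by_contra h
    simp only [Set.mem_union, Set.mem_ofPred_eq, not_or, not_not] at h
    exact hp (by simp [h.1, h.2])
  smul_mem' := by
    intro c a ha
    refine Set.Finite.subset ha ?_
    intro p hp h
    exact hp (by simp [h])

/-- The ring `𝒜_ℓ = ∏_p ℤ/p^ℓ / ⨁_p ℤ/p^ℓ`; the number `ℓ` is the superbity. -/
abbrev AdeleLike (ℓ : ℕ) : Type :=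
  (∀ p : Nat.Primes, ZMod ((p : ℕ) ^ ℓ)) ⧸ finiteSupportIdeal ℓ

/-- The element of `𝒜_ℓ` represented by the family `(a_p)_p`. -/
def AdeleLike.mk (ℓ : ℕ) (a : ∀ p : Nat.Primes, ZMod ((p : ℕ) ^ ℓ)) : AdeleLike ℓ :=
  Ideal.Quotient.mk (finiteSupportIdeal ℓ) a

/-- Reduction of a rational number modulo `p^ℓ`: it is `0` if `ord_p r < 0`, and `r mod p^ℓ` (the
denominator being then a unit modulo `p^ℓ`) if `ord_p r ≥ 0`. -/
def ratModPrimePow (p ℓ : ℕ) (r : ℚ) : ZMod (p ^ ℓ) :=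
  if padicValRat p r < 0 then 0 else (r.num : ZMod (p ^ ℓ)) * (r.den : ZMod (p ^ ℓ))⁻¹

/-- The diagonal embedding of `ℚ` in `𝒜_ℓ`. -/
def ratToAdeleLike (ℓ : ℕ) (r : ℚ) : AdeleLike ℓ :=
  AdeleLike.mk ℓ fun p => ratModPrimePow p ℓ r

/-- The `𝒜_1`-Bernoulli number `𝔟_k = (B_{p-k} / k mod p)_{p > k}`, with component `0` at `p ≤ k`. -/
noncomputable def bernoulliA1 (k : ℕ) : AdeleLike 1 :=
  AdeleLike.mk 1 fun p =>
    if k < (p : ℕ) then ratModPrimePow p 1 (bernoulli ((p : ℕ) - k) / (k : ℚ)) else 0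

/-- The finite multiple zeta value
`ζ_{𝒜_ℓ}(s_1, …, s_d) = ∑_{p > k_1 > ⋯ > k_d ≥ 1} 1 / (k_1 ^ s_1 ⋯ k_d ^ s_d) ∈ 𝒜_ℓ`.
(Every `k_j` is a unit modulo `p^ℓ`.) -/
def fmzv (ℓ : ℕ) {d : ℕ} (s : Fin d → ℕ+) : AdeleLike ℓ :=
  AdeleLike.mk ℓ fun p =>
    ∑ k ∈ Fintype.piFinset (fun _ : Fin d => Finset.Ico 1 (p : ℕ)) with
        ∀ i j : Fin d, i < j → k j < k i,
      ∏ j, ((k j : ZMod ((p : ℕ) ^ ℓ)) ^ (s j : ℕ))⁻¹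

/-- The star version
`ζ⋆_{𝒜_ℓ}(s_1, …, s_d) = ∑_{p > k_1 ≥ ⋯ ≥ k_d ≥ 1} 1 / (k_1 ^ s_1 ⋯ k_d ^ s_d) ∈ 𝒜_ℓ`. -/
def fmzvStar (ℓ : ℕ) {d : ℕ} (s : Fin d → ℕ+) : AdeleLike ℓ :=
  AdeleLike.mk ℓ fun p =>
    ∑ k ∈ Fintype.piFinset (fun _ : Fin d => Finset.Ico 1 (p : ℕ)) with
        ∀ i j : Fin d, i < j → k j ≤ k i,
      ∏ j, ((k j : ZMod ((p : ℕ) ^ ℓ)) ^ (s j : ℕ))⁻¹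

/-- The weight `s_1 + ⋯ + s_d` of `s = (s_1, …, s_d)`. -/
def compWeight {d : ℕ} (s : Fin d → ℕ+) : ℕ := ∑ j, (s j : ℕ)

/-- The depth `d` of `s = (s_1, …, s_d)`. -/
def compDepth {d : ℕ} (_s : Fin d → ℕ+) : ℕ := d

/-! Everything is checked modulo each prime `p ≥ 11`. In a triple sum H(a,b,c) over x > y > z, sum
over y last. Since the full power sum of exponent a vanishes, the tail over x > y is minus the
initial sum over x ≤ y, so up to a double sum of even weight, which is zero, H(a,b,c) = -∑ y^(-b)
S_a(y) S_c(y), where S_a(y) = ∑_{x<y} x^(-a) (`harmonicThree_eq_sum_middle`). By Fermat and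
Faulhaber each S_a is a polynomial in y with Bernoulli coefficients (`sum_Ico_invPow`), and summing
over y keeps only exponents divisible by p - 1 (`sum_mul_sum_pow`).

Thus a! c! H(a,b,c) is a convolution of B_i B_j, i + j = p - 5, weighted by a polynomial in i of
degree a + c - 2 ≤ 3, plus a multiple of B_{p-3}^2 when a, c ≤ 2 (`factorial_mul_harmonicThree`).
Only the part symmetric in i, j matters. As i + j ≡ -5, that part is A + B·ij, so two unknowns W = ∑
B_i B_j and V = ∑ ij B_i B_j govern all ten values (`sum_convolution_symm`).

The stuffle relations 3H(2,2,2) = 0 and 2H(1,1,4) + H(1,4,1) = 0 determine W and V as multiples of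
B_{p-3}^2 (`harmonicThree_weight_six`). The star values agree because all lower-depth corrections
vanish. -/

/-! ### Bernoulli numbers and Faulhaber's formula modulo p -/

/-- The rational numbers whose denominator is prime to `p`. -/
def primeToDenSubring (p : ℕ) [Fact p.Prime] : Subring ℚ where
  carrier := {r | (r.den : ZMod p) ≠ 0}
  zero_mem' := by simp
  one_mem' := by simp
  add_mem' := by
    intro a b ha hb h
    rw [ZMod.natCast_eq_zero_iff] at h
    have h' := h.trans (Rat.add_den_dvd a b)
    rw [← ZMod.natCast_eq_zero_iff, Nat.cast_mul] at h'
    exact mul_ne_zero ha hb h'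
  mul_mem' := by
    intro a b ha hb h
    rw [ZMod.natCast_eq_zero_iff] at h
    have h' := h.trans (Rat.mul_den_dvd a b)
    rw [← ZMod.natCast_eq_zero_iff, Nat.cast_mul] at h'
    exact mul_ne_zero ha hb h'
  neg_mem' := by
    intro a ha
    simpa using ha

/-- Reduction modulo `p` of the rational numbers whose denominator is prime to `p`. -/
def primeToDenSubring.reduce (p : ℕ) [Fact p.Prime] : primeToDenSubring p →+* ZMod p where
  toFun r := ((r : ℚ) : ZMod p)
  map_one' := by simp
  map_zero' := by simp
  map_add' a b := by
    push_cast
    exact Rat.cast_add_of_ne_zero a.2 b.2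
  map_mul' a b := by
    push_cast
    exact Rat.cast_mul_of_ne_zero a.2 b.2

theorem inv_natCast_mem_primeToDenSubring {p : ℕ} [Fact p.Prime] {n : ℕ} (hn : (n : ZMod p) ≠ 0) :
    (n : ℚ)⁻¹ ∈ primeToDenSubring p := by
  change (((n : ℚ)⁻¹).den : ZMod p) ≠ 0
  have h0 : n ≠ 0 := by rintro rfl; simp at hn
  rw [Rat.inv_natCast_den, if_neg h0]
  exact hn

theorem natCast_zmod_ne_zero {p n : ℕ} (h0 : 0 < n) (hn : n < p) : (n : ZMod p) ≠ 0 := by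
  rw [Ne, ZMod.natCast_eq_zero_iff]
  exact fun h => absurd (Nat.le_of_dvd h0 h) (by omega)

/-- The recursion for B_m divides only by m + 1, which is a unit modulo p in this range, so
p-integrality propagates by strong induction. -/
theorem bernoulli_mem_primeToDenSubring {p : ℕ} [Fact p.Prime] :
    ∀ m : ℕ, m + 1 < p → bernoulli m ∈ primeToDenSubring p := by
  intro m
  induction m using Nat.strong_induction_on with
  | _ m ih =>
    intro hm
    have h := sum_bernoulli (m + 1)
    rw [Finset.sum_range_succ] at h
    have hc : (((m + 1).choose m : ℕ) : ℚ) = ((m + 1 : ℕ) : ℚ) := by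
      rw [Nat.choose_succ_self_right]
    rw [hc] at h
    have h0 : ((m + 1 : ℕ) : ℚ) ≠ 0 := by positivity
    have hB : bernoulli m = ((if m + 1 = 1 then 1 else 0) -
        ∑ k ∈ Finset.range m, ((m + 1).choose k : ℚ) * bernoulli k) * ((m + 1 : ℕ) : ℚ)⁻¹ := by
      rw [← h]; field_simp; ring
    rw [hB]
    refine mul_mem (sub_mem ?_ (sum_mem fun k hk => mul_mem (natCast_mem _ _) (ih k ?_ ?_)))
      (inv_natCast_mem_primeToDenSubring (natCast_zmod_ne_zero (by omega) hm))
    · split_ifs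
      · exact one_mem _
      · exact zero_mem _
    · exact Finset.mem_range.1 hk
    · have := Finset.mem_range.1 hk
      omega

/-- Faulhaber's formula modulo `p`, for exponents less than `p - 1`. -/
theorem sum_range_pow_zmod {p : ℕ} [Fact p.Prime] (n m : ℕ) (hm : m + 1 < p) :
    (∑ k ∈ Finset.range n, (k : ZMod p) ^ m) =
      ∑ i ∈ Finset.range (m + 1), ((bernoulli i : ℚ) : ZMod p) * ((m + 1).choose i) *
        (n : ZMod p) ^ (m + 1 - i) * ((m + 1 : ℕ) : ZMod p)⁻¹ := by
  let B : ℕ → primeToDenSubring p := fun i =>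
    if h : i + 1 < p then ⟨bernoulli i, bernoulli_mem_primeToDenSubring i h⟩ else 0
  let v : primeToDenSubring p := ⟨((m + 1 : ℕ) : ℚ)⁻¹,
    inv_natCast_mem_primeToDenSubring (natCast_zmod_ne_zero (by omega) hm)⟩
  have hB : ∀ i, i < m + 1 → ((B i : primeToDenSubring p) : ℚ) = bernoulli i := by
    intro i hi
    simp only [B]
    rw [dif_pos (by omega)]
  have key : (∑ k ∈ Finset.range n, (k : primeToDenSubring p) ^ m) =
      ∑ i ∈ Finset.range (m + 1), B i * ((m + 1).choose i : primeToDenSubring p) *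
        (n : primeToDenSubring p) ^ (m + 1 - i) * v := by
    apply Subtype.ext
    push_cast
    rw [sum_range_pow]
    refine Finset.sum_congr rfl fun i hi => ?_
    rw [hB i (Finset.mem_range.1 hi), div_eq_mul_inv]
    simp [v]
  have hv : primeToDenSubring.reduce p v = ((m + 1 : ℕ) : ZMod p)⁻¹ := by
    apply eq_inv_of_mul_eq_one_left
    rw [← map_natCast (primeToDenSubring.reduce p) (m + 1), ← map_mul]
    have : v * ((m + 1 : ℕ) : primeToDenSubring p) = 1 := by
      apply Subtype.ext
      have h0 : ((m + 1 : ℕ) : ℚ) ≠ 0 := by positivity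
      change ((m + 1 : ℕ) : ℚ)⁻¹ * (((m + 1 : ℕ) : primeToDenSubring p) : ℚ) = 1
      rw [SubringClass.coe_natCast]
      exact inv_mul_cancel₀ h0
    rw [this, map_one]
  have := congrArg (primeToDenSubring.reduce p) key
  rw [map_sum, map_sum] at this
  simp only [map_mul, map_pow, map_natCast, hv] at this
  rw [this]
  refine Finset.sum_congr rfl fun i hi => ?_
  have : primeToDenSubring.reduce p (B i) = ((bernoulli i : ℚ) : ZMod p) := by
    change (((B i : primeToDenSubring p) : ℚ) : ZMod p) = _
    rw [hB i (Finset.mem_range.1 hi)]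
  rw [this]

/-! ### Binomial coefficients near p -/

theorem choose_prime_sub_one_zmod {p : ℕ} [Fact p.Prime] (i : ℕ) (hi : i < p) :
    ((p - 1).choose i : ZMod p) = (-1) ^ i := by
  induction i with
  | zero => simp
  | succ i ih =>
    have hp := (Fact.out : p.Prime)
    have h1 : (p - 1).choose i + (p - 1).choose (i + 1) = p.choose (i + 1) := by
      conv_rhs => rw [← Nat.succ_pred_eq_of_pos hp.pos]
      rw [Nat.choose_succ_succ]; rfl
    have h2 : (p.choose (i + 1) : ZMod p) = 0 := by
      rw [ZMod.natCast_eq_zero_iff]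
      exact hp.dvd_choose_self (by omega) hi
    rw [← h1, Nat.cast_add, ih (by omega)] at h2
    rw [pow_succ]
    linear_combination h2

/-- The rising factorial `(x + 1) ⋯ (x + a - 1)`. -/
def shiftedRising {R : Type*} [CommRing R] (a : ℕ) (x : R) : R :=
  ∏ t ∈ Finset.range (a - 1), (x + t + 1)

/-- Induction from C(p-1, i) ≡ (-1)^i, lowering the top entry by C(n, i)(n+1) = C(n+1, i)(n+1-i).
This turns the Faulhaber binomials into polynomials in i. -/
theorem factorial_mul_choose_prime_sub_zmod {p : ℕ} [Fact p.Prime] (a i : ℕ) (hi : i + a + 1 ≤ p) :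
    (a.factorial : ZMod p) * ((p - (a + 1)).choose i : ZMod p) =
      (-1) ^ i * shiftedRising (a + 1) (i : ZMod p) := by
  induction a with
  | zero => simpa [shiftedRising] using choose_prime_sub_one_zmod i (by omega)
  | succ a ih =>
    have h := Nat.choose_mul_succ_eq (p - (a + 2)) i
    have e1 : p - (a + 2) + 1 = p - (a + 1) := by omega
    rw [e1] at h
    have h' := congrArg (Nat.cast : ℕ → ZMod p) h
    rw [Nat.cast_mul, Nat.cast_mul, Nat.cast_sub (by omega : i ≤ p - (a + 1)),
      Nat.cast_sub (by omega : a + 1 ≤ p)] at h'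
    simp only [CharP.cast_eq_zero] at h'
    have ih' := ih (by omega)
    simp only [shiftedRising, Nat.add_sub_cancel] at ih' ⊢
    rw [Finset.prod_range_succ, Nat.factorial_succ, ← mul_assoc, ← ih']
    push_cast at h' ⊢
    linear_combination (-(a.factorial : ZMod p)) * h'

/-! ### Harmonic sums, reflection and stuffle relations -/

/-- The reciprocal power `1 / k ^ a` in `ZMod n`. -/
def invPow (n a k : ℕ) : ZMod n := ((k : ZMod n) ^ a)⁻¹

/-- The power sum `∑_{0 < x < p} 1 / x ^ a` in `ZMod n`. -/
def harmonicOne (n p a : ℕ) : ZMod n := ∑ x ∈ Finset.Ico 1 p, invPow n a x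

/-- The double sum `∑_{p > x > y > 0} 1 / (x ^ a y ^ b)` in `ZMod n`. -/
def harmonicTwo (n p a b : ℕ) : ZMod n :=
  ∑ x ∈ Finset.Ico 1 p, ∑ y ∈ Finset.Ico 1 p, if y < x then invPow n a x * invPow n b y else 0

/-- The triple sum `∑_{p > x > y > z > 0} 1 / (x ^ a y ^ b z ^ c)` in `ZMod n`. -/
def harmonicThree (n p a b c : ℕ) : ZMod n :=
  ∑ x ∈ Finset.Ico 1 p, ∑ y ∈ Finset.Ico 1 p, ∑ z ∈ Finset.Ico 1 p,
    if y < x ∧ z < y then invPow n a x * invPow n b y * invPow n c z else 0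

/-- The triple sum `∑_{p > x ≥ y ≥ z > 0} 1 / (x ^ a y ^ b z ^ c)` in `ZMod n`. -/
def harmonicStarThree (n p a b c : ℕ) : ZMod n :=
  ∑ x ∈ Finset.Ico 1 p, ∑ y ∈ Finset.Ico 1 p, ∑ z ∈ Finset.Ico 1 p,
    if y ≤ x ∧ z ≤ y then invPow n a x * invPow n b y * invPow n c z else 0

theorem sum_Ico_one_reflect {M : Type*} [AddCommMonoid M] (p : ℕ) (f : ℕ → M) :
    ∑ x ∈ Finset.Ico 1 p, f (p - x) = ∑ x ∈ Finset.Ico 1 p, f x := by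
  refine Finset.sum_bij' (fun x _ => p - x) (fun x _ => p - x) ?_ ?_ ?_ ?_ ?_ <;>
    intros <;> simp only [Finset.mem_Ico] at * <;> omega

section

variable {p : ℕ} [Fact p.Prime]

theorem invPow_mul_invPow (a b k : ℕ) : invPow p a k * invPow p b k = invPow p (a + b) k := by
  simp only [invPow, pow_add, mul_inv]

theorem invPow_eq_pow {a k : ℕ} (ha : a ≤ p - 1) (hk : k ∈ Finset.Ico 1 p) :
    invPow p a k = (k : ZMod p) ^ (p - 1 - a) := by
  rw [Finset.mem_Ico] at hk
  have h0 : (k : ZMod p) ≠ 0 := natCast_zmod_ne_zero (by omega) hk.2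
  symm
  apply eq_inv_of_mul_eq_one_left
  rw [← pow_add, Nat.sub_add_cancel ha]
  exact ZMod.pow_card_sub_one_eq_one h0

theorem sum_Ico_pow_zmod (e : ℕ) :
    ∑ x ∈ Finset.Ico 1 p, (x : ZMod p) ^ e = if p - 1 ∣ e then -1 else 0 := by
  classical
  have h := FiniteField.sum_pow_units (ZMod p) e
  rw [ZMod.card] at h
  rw [← h]
  have hp := (Fact.out : p.Prime)
  symm
  refine Finset.sum_bij (fun (x : (ZMod p)ˣ) _ => (x : ZMod p).val) ?_ ?_ ?_ ?_
  · intro x _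
    rw [Finset.mem_Ico]
    refine ⟨Nat.pos_of_ne_zero fun h0 => x.ne_zero ?_, ZMod.val_lt _⟩
    exact (ZMod.val_eq_zero _).1 h0
  · intro x _ y _ hxy
    exact Units.ext (ZMod.val_injective p hxy)
  · intro k hk
    rw [Finset.mem_Ico] at hk
    refine ⟨Units.mk0 (k : ZMod p) (natCast_zmod_ne_zero (by omega) hk.2), Finset.mem_univ _, ?_⟩
    exact ZMod.val_cast_of_lt hk.2
  · intro x _
    simp

theorem harmonicOne_eq_zero {a : ℕ} (h0 : 0 < a) (ha : a < p - 1) : harmonicOne p p a = 0 := by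
  rw [harmonicOne, Finset.sum_congr rfl fun x hx => invPow_eq_pow ha.le hx, sum_Ico_pow_zmod,
    if_neg]
  intro h
  exact absurd (Nat.le_of_dvd (by omega) h) (by omega)

theorem invPow_reflect {x : ℕ} (a : ℕ) (hx : x ≤ p) :
    invPow p a (p - x) = (-1) ^ a * invPow p a x := by
  rw [invPow, invPow, Nat.cast_sub hx, CharP.cast_eq_zero, zero_sub, neg_pow, mul_inv]
  congr 1
  rcases neg_one_pow_eq_or (ZMod p) a with h | h <;> simp [h, inv_neg]

/-- The substitution k ↦ p - k reverses the order and multiplies each k^(-a) by (-1)^a. -/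
theorem harmonicTwo_reverse (a b : ℕ) :
    harmonicTwo p p a b = (-1) ^ (a + b) * harmonicTwo p p b a := by
  rw [harmonicTwo, ← sum_Ico_one_reflect, harmonicTwo, Finset.sum_comm, Finset.mul_sum]
  rw [← sum_Ico_one_reflect]
  refine Finset.sum_congr rfl fun x hx => ?_
  rw [Finset.mul_sum]
  refine Finset.sum_congr rfl fun y hy => ?_
  rw [Finset.mem_Ico] at hx hy
  by_cases h : y < x
  · rw [if_pos (by omega), if_pos h, invPow_reflect _ (by omega), invPow_reflect _ (by omega)]
    ring
  · rw [if_neg (by omega), if_neg h, mul_zero]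

theorem harmonicOne_mul_harmonicOne (a b : ℕ) :
    harmonicOne p p a * harmonicOne p p b =
      harmonicTwo p p a b + harmonicTwo p p b a + harmonicOne p p (a + b) := by
  have h1 : harmonicOne p p (a + b) = ∑ x ∈ Finset.Ico 1 p, ∑ y ∈ Finset.Ico 1 p,
      if y = x then invPow p a x * invPow p b y else 0 := by
    refine Finset.sum_congr rfl fun x hx => ?_
    rw [Finset.sum_ite_eq', if_pos hx, invPow_mul_invPow]
  have h2 : harmonicTwo p p b a = ∑ x ∈ Finset.Ico 1 p, ∑ y ∈ Finset.Ico 1 p,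
      if x < y then invPow p a x * invPow p b y else 0 := by
    rw [harmonicTwo, Finset.sum_comm]
    simp only [mul_comm (invPow p b _)]
  rw [h1, h2, harmonicTwo, harmonicOne, harmonicOne, Finset.sum_mul_sum]
  simp only [← Finset.sum_add_distrib]
  refine Finset.sum_congr rfl fun x hx => Finset.sum_congr rfl fun y hy => ?_
  rcases lt_trichotomy x y with h | h | h
  · simp [h, h.not_gt, h.ne']
  · simp [h]
  · simp [h, h.not_gt, h.ne]

/-- The stuffle product makes H(a,b) + H(b,a) zero, while reflection in even weight makes the two
summands equal. -/
theorem harmonicTwo_eq_zero {a b : ℕ} (ha : 0 < a) (hab : Even (a + b)) (h : a + b < p - 1)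
    (hb : 0 < b) : harmonicTwo p p a b = 0 := by
  have h1 := harmonicOne_mul_harmonicOne (p := p) a b
  rw [harmonicOne_eq_zero ha (by omega), harmonicOne_eq_zero (by omega) h,
    harmonicTwo_reverse b a, add_comm b a, hab.neg_one_pow] at h1
  have h2 : ((2 : ℕ) : ZMod p) ≠ 0 := natCast_zmod_ne_zero (by omega) (by omega)
  push_cast at h2
  have h3 : (2 : ZMod p) * harmonicTwo p p a b = 0 := by linear_combination -h1
  exact (mul_eq_zero.1 h3).resolve_left h2

theorem harmonicTwo_add_left (a b c : ℕ) : harmonicTwo p p (a + b) c =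
    ∑ x ∈ Finset.Ico 1 p, ∑ y ∈ Finset.Ico 1 p, ∑ z ∈ Finset.Ico 1 p,
      if y = x ∧ z < y then invPow p a x * invPow p b y * invPow p c z else 0 := by
  refine Finset.sum_congr rfl fun x hx => ?_
  rw [Finset.sum_comm]
  refine Finset.sum_congr rfl fun z hz => ?_
  simp only [ite_and]
  rw [Finset.sum_ite_eq', if_pos hx, invPow_mul_invPow]

theorem harmonicTwo_add_right (a b c : ℕ) : harmonicTwo p p a (b + c) =
    ∑ x ∈ Finset.Ico 1 p, ∑ y ∈ Finset.Ico 1 p, ∑ z ∈ Finset.Ico 1 p,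
      if y < x ∧ z = y then invPow p a x * invPow p b y * invPow p c z else 0 := by
  refine Finset.sum_congr rfl fun x hx => Finset.sum_congr rfl fun y hy => ?_
  simp only [and_comm (a := y < x), ite_and]
  rw [Finset.sum_ite_eq', if_pos hy, mul_assoc, invPow_mul_invPow]

/-- Stuffle product: for y > z the new index x lies in one of three gaps or coincides with y or z.
-/
theorem harmonicOne_mul_harmonicTwo (a b c : ℕ) :
    harmonicOne p p a * harmonicTwo p p b c =
      harmonicThree p p a b c + harmonicThree p p b a c + harmonicThree p p b c a +
        harmonicTwo p p (a + b) c + harmonicTwo p p b (a + c) := by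
  have e1 : harmonicThree p p b a c = ∑ x ∈ Finset.Ico 1 p, ∑ y ∈ Finset.Ico 1 p,
      ∑ z ∈ Finset.Ico 1 p,
        if x < y ∧ z < x then invPow p a x * (invPow p b y * invPow p c z) else 0 := by
    rw [harmonicThree, Finset.sum_comm]
    refine Finset.sum_congr rfl fun x _ => Finset.sum_congr rfl fun y _ =>
      Finset.sum_congr rfl fun z _ => ?_
    split_ifs
    · ring
    · rfl
  have e2 : harmonicThree p p b c a = ∑ x ∈ Finset.Ico 1 p, ∑ y ∈ Finset.Ico 1 p,
      ∑ z ∈ Finset.Ico 1 p,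
        if z < y ∧ x < z then invPow p a x * (invPow p b y * invPow p c z) else 0 := by
    rw [harmonicThree, Finset.sum_congr rfl fun x _ => Finset.sum_comm, Finset.sum_comm]
    refine Finset.sum_congr rfl fun x _ => Finset.sum_congr rfl fun y _ =>
      Finset.sum_congr rfl fun z _ => ?_
    split_ifs
    · ring
    · rfl
  have e3 : harmonicTwo p p b (a + c) = ∑ x ∈ Finset.Ico 1 p, ∑ y ∈ Finset.Ico 1 p,
      ∑ z ∈ Finset.Ico 1 p,
        if x < y ∧ z = x then invPow p a x * (invPow p b y * invPow p c z) else 0 := by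
    rw [harmonicTwo_add_right, Finset.sum_comm]
    refine Finset.sum_congr rfl fun x _ => Finset.sum_congr rfl fun y _ =>
      Finset.sum_congr rfl fun z _ => ?_
    split_ifs
    · ring
    · rfl
  rw [e1, e2, e3, harmonicTwo_add_left, harmonicThree, harmonicOne, harmonicTwo, Finset.sum_mul]
  simp only [Finset.mul_sum, ← Finset.sum_add_distrib]
  refine Finset.sum_congr rfl fun x _ => Finset.sum_congr rfl fun y _ =>
    Finset.sum_congr rfl fun z _ => ?_
  rw [mul_assoc]
  by_cases h : z < y
  · rcases lt_trichotomy x y with hxy | hxy | hxy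
    · rcases lt_trichotomy x z with hxz | hxz | hxz
      · simp [h, hxy, hxz, hxy.not_gt, hxz.not_gt, hxy.ne', hxz.ne']
      · subst hxz; simp [hxy, hxy.not_gt, hxy.ne']
      · simp [h, hxy, hxz, hxy.not_gt, hxz.not_gt, hxy.ne', hxz.ne]
    · subst hxy; simp [h, h.not_gt, h.ne]
    · have hxz := h.trans hxy
      simp [h, hxy, hxy.not_gt, hxz.not_gt, hxy.ne]
  · have h1 : ¬ (x < y ∧ z < x) := by omega
    have h2 : ¬ (x < y ∧ z = x) := by omega
    simp [h, h1, h2]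

theorem harmonicStarThree_eq (a b c : ℕ) :
    harmonicStarThree p p a b c = harmonicThree p p a b c + harmonicTwo p p (a + b) c +
      harmonicTwo p p a (b + c) + harmonicOne p p (a + b + c) := by
  have e : harmonicOne p p (a + b + c) = ∑ x ∈ Finset.Ico 1 p, ∑ y ∈ Finset.Ico 1 p,
      ∑ z ∈ Finset.Ico 1 p,
        if y = x ∧ z = y then invPow p a x * invPow p b y * invPow p c z else 0 := by
    refine Finset.sum_congr rfl fun x hx => ?_
    rw [Finset.sum_comm]
    simp only [ite_and, Finset.sum_ite_eq', if_pos hx]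
    rw [invPow_mul_invPow, invPow_mul_invPow]
  rw [e, harmonicTwo_add_left, harmonicTwo_add_right, harmonicThree, harmonicStarThree]
  simp only [← Finset.sum_add_distrib]
  refine Finset.sum_congr rfl fun x _ => Finset.sum_congr rfl fun y _ =>
    Finset.sum_congr rfl fun z _ => ?_
  rcases lt_trichotomy x y with hxy | hxy | hxy
  · simp [hxy.not_ge, hxy.not_gt, hxy.ne']
  · rcases lt_trichotomy y z with hyz | hyz | hyz
    · simp [hyz.not_ge, hyz.not_gt, hyz.ne']
    · simp [hxy, hyz]
    · simp [hxy, hyz, hyz.le, hyz.ne]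
  · rcases lt_trichotomy y z with hyz | hyz | hyz
    · simp [hyz.not_ge, hyz.not_gt, hyz.ne']
    · subst hyz; simp [hxy, hxy.le, hxy.ne]
    · simp [hxy, hxy.le, hxy.ne, hyz, hyz.le, hyz.ne]

/-- The middle variable of a triple sum is summed last; the sum over the largest variable is
complementary to a sum over a smaller variable. -/
theorem harmonicThree_eq_sum_middle {a b c : ℕ} (h0 : 0 < a) (ha : a < p - 1) :
    harmonicThree p p a b c = -(∑ y ∈ Finset.Ico 1 p, invPow p b y *
      (∑ x ∈ Finset.Ico 1 y, invPow p a x) * (∑ z ∈ Finset.Ico 1 y, invPow p c z)) -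
        harmonicTwo p p (a + b) c := by
  have hs : ∀ y ∈ Finset.Ico 1 p, ∀ f : ℕ → ZMod p,
      ∑ x ∈ Finset.Ico 1 y, f x = ∑ x ∈ Finset.Ico 1 p, if x < y then f x else 0 := by
    intro y hy f
    rw [← Finset.sum_filter]
    refine Finset.sum_congr ?_ fun _ _ => rfl
    ext x
    simp only [Finset.mem_Ico, Finset.mem_filter] at hy ⊢
    omega
  -- The sum over all x is zero, so the part above y is minus the part below y minus the term at y;
  -- the latter produces the double sum.
  have hgt : ∀ y ∈ Finset.Ico 1 p, (∑ x ∈ Finset.Ico 1 p, if y < x then invPow p a x else 0) =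
      -(∑ x ∈ Finset.Ico 1 y, invPow p a x) - invPow p a y := by
    intro y hy
    have h1 := harmonicOne_eq_zero h0 ha
    have h2 : ∑ x ∈ Finset.Ico 1 p, (if x = y then invPow p a x else 0) = invPow p a y := by
      rw [Finset.sum_ite_eq', if_pos hy]
    have h3 : (∑ x ∈ Finset.Ico 1 p, if y < x then invPow p a x else 0) +
        (∑ x ∈ Finset.Ico 1 p, if x < y then invPow p a x else 0) +
          (∑ x ∈ Finset.Ico 1 p, if x = y then invPow p a x else 0) = harmonicOne p p a := by
      rw [harmonicOne]
      simp only [← Finset.sum_add_distrib]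
      refine Finset.sum_congr rfl fun x _ => ?_
      rcases lt_trichotomy x y with h | h | h
      · simp [h, h.not_gt, h.ne]
      · simp [h]
      · simp [h, h.not_gt, h.ne']
    rw [hs y hy]
    linear_combination h3 + h1 - h2
  have h3 : harmonicThree p p a b c = ∑ y ∈ Finset.Ico 1 p, invPow p b y *
      (∑ x ∈ Finset.Ico 1 p, if y < x then invPow p a x else 0) *
        (∑ z ∈ Finset.Ico 1 y, invPow p c z) := by
    rw [harmonicThree, Finset.sum_comm]
    refine Finset.sum_congr rfl fun y hy => ?_
    rw [hs y hy, mul_assoc, Finset.sum_mul_sum, Finset.mul_sum]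
    refine Finset.sum_congr rfl fun x _ => ?_
    rw [Finset.mul_sum]
    refine Finset.sum_congr rfl fun z _ => ?_
    by_cases h : y < x <;> by_cases h' : z < y <;> (simp [h, h']; try ring)
  have h4 : harmonicTwo p p (a + b) c = ∑ y ∈ Finset.Ico 1 p, invPow p b y * invPow p a y *
      (∑ z ∈ Finset.Ico 1 y, invPow p c z) := by
    refine Finset.sum_congr rfl fun y hy => ?_
    rw [hs y hy, Finset.mul_sum]
    refine Finset.sum_congr rfl fun z _ => ?_
    rw [mul_comm (invPow p b y), invPow_mul_invPow, mul_ite, mul_zero]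
  rw [h3, h4, ← Finset.sum_neg_distrib, ← Finset.sum_sub_distrib]
  refine Finset.sum_congr rfl fun y hy => ?_
  rw [hgt y hy]
  ring

end

/-! ### Reduction to convolutions of Bernoulli numbers -/

section

variable {p : ℕ} [Fact p.Prime]

/-- The coefficient of `y ^ (p - a - i)` in the polynomial expressing `∑_{x < y} 1 / x ^ a`. -/
def partialSumCoeff (p a i : ℕ) [Fact p.Prime] : ZMod p :=
  -((bernoulli i : ℚ) : ZMod p) * ((p - a).choose i) * (a : ZMod p)⁻¹

theorem sum_Ico_invPow {a y : ℕ} (h0 : 0 < a) (ha : a < p - 1) (hy : y ≤ p) :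
    ∑ x ∈ Finset.Ico 1 y, invPow p a x =
      ∑ i ∈ Finset.range (p - a), partialSumCoeff p a i * (y : ZMod p) ^ (p - a - i) := by
  have h1 : ∑ x ∈ Finset.Ico 1 y, invPow p a x =
      ∑ x ∈ Finset.Ico 1 y, (x : ZMod p) ^ (p - 1 - a) := by
    refine Finset.sum_congr rfl fun x hx => invPow_eq_pow ha.le ?_
    rw [Finset.mem_Ico] at hx ⊢
    omega
  have h2 : ∑ x ∈ Finset.Ico 1 y, (x : ZMod p) ^ (p - 1 - a) =
      ∑ x ∈ Finset.range y, (x : ZMod p) ^ (p - 1 - a) := by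
    refine Finset.sum_subset (fun x => ?_) fun x hx hx' => ?_
    · simp only [Finset.mem_Ico, Finset.mem_range]; omega
    · rw [Finset.mem_Ico] at hx'
      rw [Finset.mem_range] at hx
      have : x = 0 := by omega
      -- The strict bound a < p - 1 keeps the exponent positive, so the term x = 0 is harmless.
      rw [this, Nat.cast_zero, zero_pow (by omega)]
  rw [h1, h2, sum_range_pow_zmod _ _ (by omega), show p - 1 - a + 1 = p - a by omega,
    Nat.cast_sub (by omega : a ≤ p), CharP.cast_eq_zero (ZMod p) p, zero_sub, inv_neg]
  refine Finset.sum_congr rfl fun i _ => ?_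
  rw [partialSumCoeff]
  ring

/-- The total exponent of y is 3p - 7 - (i + j). It is a multiple of p - 1 only for i + j = p - 5 or
i + j = 2p - 6. In the second case both indices are at most p - 2, and the vanishing at p - 2 leaves
only i = j = p - 3, which is in range exactly when a, c ≤ 2. -/
theorem sum_mul_sum_pow {a b c : ℕ} (h0 : 0 < a) (h1 : 0 < b) (h2 : 0 < c) (hw : a + b + c = 6)
    (hp : 11 ≤ p) (g h : ℕ → ZMod p) (hg : g (p - 2) = 0) (hh : h (p - 2) = 0) :
    ∑ y ∈ Finset.Ico 1 p, invPow p b y *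
      (∑ i ∈ Finset.range (p - a), g i * (y : ZMod p) ^ (p - a - i)) *
        (∑ j ∈ Finset.range (p - c), h j * (y : ZMod p) ^ (p - c - j)) =
      -(∑ i ∈ Finset.range (p - 4), g i * h (p - 5 - i)) -
        (if a ≤ 2 ∧ c ≤ 2 then g (p - 3) * h (p - 3) else 0) := by
  have e1 : ∑ y ∈ Finset.Ico 1 p, invPow p b y *
      (∑ i ∈ Finset.range (p - a), g i * (y : ZMod p) ^ (p - a - i)) *
        (∑ j ∈ Finset.range (p - c), h j * (y : ZMod p) ^ (p - c - j)) =
      ∑ i ∈ Finset.range (p - a), ∑ j ∈ Finset.range (p - c), g i * h j *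
        ∑ y ∈ Finset.Ico 1 p, (y : ZMod p) ^ ((p - 1 - b) + (p - a - i) + (p - c - j)) := by
    trans ∑ y ∈ Finset.Ico 1 p, ∑ i ∈ Finset.range (p - a), ∑ j ∈ Finset.range (p - c),
        g i * h j * (y : ZMod p) ^ ((p - 1 - b) + (p - a - i) + (p - c - j))
    · refine Finset.sum_congr rfl fun y hy => ?_
      rw [mul_assoc, Finset.sum_mul_sum, Finset.mul_sum]
      refine Finset.sum_congr rfl fun i _ => ?_
      rw [Finset.mul_sum]
      refine Finset.sum_congr rfl fun j _ => ?_
      rw [invPow_eq_pow (by omega) hy, pow_add, pow_add]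
      ring
    · rw [Finset.sum_comm]
      refine Finset.sum_congr rfl fun i _ => ?_
      rw [Finset.sum_comm]
      simp only [Finset.mul_sum]
  have e2 : ∀ i ∈ Finset.range (p - a), ∀ j ∈ Finset.range (p - c), g i * h j *
      ∑ y ∈ Finset.Ico 1 p, (y : ZMod p) ^ ((p - 1 - b) + (p - a - i) + (p - c - j)) =
      -(if i + j = p - 5 then g i * h j else 0) -
        (if i + j = 2 * p - 6 then g i * h j else 0) := by
    intro i hi j hj
    rw [Finset.mem_range] at hi hj
    rw [sum_Ico_pow_zmod]
    by_cases hA : i + j = p - 5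
    · rw [if_pos hA, if_pos ⟨2, by omega⟩, if_neg (by omega)]
      ring
    · by_cases hB : i + j = 2 * p - 6
      · rw [if_neg hA, if_pos hB, if_pos ⟨1, by omega⟩]
        ring
      · rw [if_neg hA, if_neg hB, if_neg]
        · ring
        · rintro ⟨k, hk⟩
          rcases k with _ | _ | _ | k
          · omega
          · omega
          · omega
          · have : (p - 1) * 3 ≤ (p - 1) * (k + 3) := Nat.mul_le_mul_left _ (by omega)
            have e : k + 1 + 1 + 1 = k + 3 := rfl
            rw [e] at hk
            omega
  have e3 : ∑ i ∈ Finset.range (p - a), ∑ j ∈ Finset.range (p - c),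
      (if i + j = p - 5 then g i * h j else 0) =
        ∑ i ∈ Finset.range (p - 4), g i * h (p - 5 - i) := by
    symm
    have hsub : Finset.range (p - 4) ⊆ Finset.range (p - a) := by
      intro i; simp only [Finset.mem_range]; omega
    rw [← Finset.sum_subset hsub]
    · refine Finset.sum_congr rfl fun i hi => ?_
      rw [Finset.mem_range] at hi
      rw [Finset.sum_eq_single (p - 5 - i)]
      · rw [if_pos (by omega)]
      · intro j _ hj
        rw [if_neg (by omega)]
      · intro hj
        rw [Finset.mem_range] at hj
        omega
    · intro i _ hi
      rw [Finset.mem_range] at hi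
      refine Finset.sum_eq_zero fun j _ => ?_
      rw [if_neg (by omega)]
  have e4 : ∑ i ∈ Finset.range (p - a), ∑ j ∈ Finset.range (p - c),
      (if i + j = 2 * p - 6 then g i * h j else 0) =
        if a ≤ 2 ∧ c ≤ 2 then g (p - 3) * h (p - 3) else 0 := by
    have e5 : ∀ i ∈ Finset.range (p - a), ∀ j ∈ Finset.range (p - c),
        (if i + j = 2 * p - 6 then g i * h j else 0) =
          if i = p - 3 then (if j = p - 3 then g i * h j else 0) else 0 := by
      intro i hi j hj
      rw [Finset.mem_range] at hi hj
      by_cases hi3 : i = p - 3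
      · rw [if_pos hi3]
        refine if_congr (by omega) rfl rfl
      · rw [if_neg hi3]
        by_cases hij : i + j = 2 * p - 6
        · rw [if_pos hij]
          rcases (by omega : i = p - 2 ∨ j = p - 2) with h | h
          · rw [h, hg, zero_mul]
          · rw [h, hh, mul_zero]
        · rw [if_neg hij]
    rw [Finset.sum_congr rfl fun i hi => Finset.sum_congr rfl fun j hj => e5 i hi j hj]
    rw [Finset.sum_comm]
    simp only [Finset.sum_ite_eq']
    rw [Finset.sum_ite_irrel]
    simp only [Finset.sum_ite_eq', Finset.sum_const_zero, Finset.mem_range]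
    rw [← ite_and]
    exact if_congr (by omega) rfl rfl
  rw [e1, Finset.sum_congr rfl fun i hi => Finset.sum_congr rfl fun j hj => e2 i hi j hj]
  simp only [Finset.sum_sub_distrib, Finset.sum_neg_distrib]
  rw [e3, e4]

theorem factorial_mul_partialSumCoeff {a i : ℕ} (h0 : 0 < a) (hi : i + a ≤ p) (ha : a < p) :
    (a.factorial : ZMod p) * partialSumCoeff p a i =
      -((bernoulli i : ℚ) : ZMod p) * (-1) ^ i * shiftedRising a (i : ZMod p) := by
  obtain ⟨a, rfl⟩ : ∃ b, a = b + 1 := ⟨a - 1, by omega⟩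
  have h := factorial_mul_choose_prime_sub_zmod (p := p) a i (by omega)
  have hz : ((a + 1 : ℕ) : ZMod p) ≠ 0 := natCast_zmod_ne_zero h0 ha
  rw [partialSumCoeff, Nat.factorial_succ, Nat.cast_mul, mul_assoc _ ((-1) ^ i), ← h]
  field_simp

theorem cast_bernoulli_eq_zero {i : ℕ} (h : Odd i) (hi : 1 < i) :
    ((bernoulli i : ℚ) : ZMod p) = 0 := by
  rw [bernoulli_eq_zero_of_odd h hi, Rat.cast_zero]

/-- A triple harmonic sum of weight `6` as a convolution of Bernoulli numbers. -/
theorem factorial_mul_harmonicThree {a b c : ℕ} (h0 : 0 < a) (h1 : 0 < b) (h2 : 0 < c)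
    (hw : a + b + c = 6) (hp : 11 ≤ p) :
    (a.factorial : ZMod p) * c.factorial * harmonicThree p p a b c =
      ∑ i ∈ Finset.range (p - 4), ((bernoulli i : ℚ) : ZMod p) *
        ((bernoulli (p - 5 - i) : ℚ) : ZMod p) *
          (shiftedRising a (i : ZMod p) * shiftedRising c (-5 - i : ZMod p)) +
      if a ≤ 2 ∧ c ≤ 2 then ((bernoulli (p - 3) : ℚ) : ZMod p) ^ 2 *
        (shiftedRising a (-3 : ZMod p) * shiftedRising c (-3 : ZMod p)) else 0 := by
  -- Since p - 2 is odd and exceeds 1, B_{p-2} = 0, as the extraction of exponents requires.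
  have hodd : Odd p := (Fact.out : p.Prime).odd_of_ne_two (by omega)
  have hz : ∀ d, partialSumCoeff p d (p - 2) = 0 := fun d => by
    rw [partialSumCoeff, cast_bernoulli_eq_zero (Nat.Odd.sub_even (by omega) hodd even_two)
      (by omega), neg_zero, zero_mul, zero_mul]
  rw [harmonicThree_eq_sum_middle h0 (by omega), harmonicTwo_eq_zero (by omega)
    (by rw [hw]; decide) (by omega) h2, sub_zero,
    Finset.sum_congr rfl fun y hy => by
      rw [sum_Ico_invPow h0 (by omega) (Finset.mem_Ico.1 hy).2.le,
        sum_Ico_invPow h2 (by omega) (Finset.mem_Ico.1 hy).2.le],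
    sum_mul_sum_pow h0 h1 h2 hw hp _ _ (hz a) (hz c), neg_sub, sub_neg_eq_add, mul_add, add_comm,
    Finset.mul_sum]
  congr 1
  · refine Finset.sum_congr rfl fun i hi => ?_
    rw [Finset.mem_range] at hi
    have ha := factorial_mul_partialSumCoeff (p := p) (a := a) (i := i) h0 (by omega) (by omega)
    have hc := factorial_mul_partialSumCoeff (p := p) (a := c) (i := p - 5 - i) h2 (by omega)
      (by omega)
    have hj : ((p - 5 - i : ℕ) : ZMod p) = -5 - i := by
      rw [Nat.cast_sub (by omega), Nat.cast_sub (by omega), CharP.cast_eq_zero]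
      push_cast
      ring
    have hs : ((-1) ^ i * (-1) ^ (p - 5 - i) : ZMod p) = 1 := by
      rw [← pow_add, show i + (p - 5 - i) = p - 5 by omega]
      exact (Nat.Odd.sub_odd hodd (by decide)).neg_one_pow
    rw [hj] at hc
    calc _ = (a.factorial * partialSumCoeff p a i) *
          (c.factorial * partialSumCoeff p c (p - 5 - i)) := by ring
      _ = _ := by
        rw [ha, hc]
        linear_combination (((bernoulli i : ℚ) : ZMod p) *
          ((bernoulli (p - 5 - i) : ℚ) : ZMod p) *
          (shiftedRising a (i : ZMod p) * shiftedRising c (-5 - i : ZMod p))) * hs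
  · split_ifs with hac
    · have ha := factorial_mul_partialSumCoeff (p := p) (a := a) (i := p - 3) h0 (by omega)
        (by omega)
      have hc := factorial_mul_partialSumCoeff (p := p) (a := c) (i := p - 3) h2 (by omega)
        (by omega)
      have hj : ((p - 3 : ℕ) : ZMod p) = -3 := by
        rw [Nat.cast_sub (by omega), CharP.cast_eq_zero]
        push_cast
        ring
      rw [(Nat.Odd.sub_odd hodd (by decide : Odd 3)).neg_one_pow, hj] at ha hc
      calc _ = (a.factorial * partialSumCoeff p a (p - 3)) *
            (c.factorial * partialSumCoeff p c (p - 3)) := by ring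
        _ = _ := by
          rw [ha, hc]
          ring
    · rw [mul_zero]

/-- A convolution sum over `i + j = p - 5` depends only on the symmetrization of the weight. -/
theorem sum_convolution_symm (hp : 5 ≤ p) (w : ℕ → ZMod p) (f : ZMod p → ZMod p) (A B : ZMod p)
    (h2 : (2 : ZMod p) ≠ 0) (hf : ∀ x, f x + f (-5 - x) = 2 * (A + B * (x * (-5 - x)))) :
    ∑ i ∈ Finset.range (p - 4), w i * w (p - 5 - i) * f i =
      A * ∑ i ∈ Finset.range (p - 4), w i * w (p - 5 - i) +
      B * ∑ i ∈ Finset.range (p - 4), w i * w (p - 5 - i) * ((i : ZMod p) * (-5 - i)) := by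
  apply mul_left_cancel₀ h2
  have h := Finset.sum_range_reflect (fun i => w i * w (p - 5 - i) * f i) (p - 4)
  rw [two_mul]
  -- One of the two copies is replaced by its reflection i ↦ p - 5 - i, so the weight appears
  -- symmetrized.
  nth_rewrite 1 [← h]
  rw [← Finset.sum_add_distrib, mul_add, Finset.mul_sum, Finset.mul_sum, Finset.mul_sum,
    Finset.mul_sum, ← Finset.sum_add_distrib]
  refine Finset.sum_congr rfl fun i hi => ?_
  rw [Finset.mem_range] at hi
  have e : p - 4 - 1 - i = p - 5 - i := by omega
  have e' : p - 5 - (p - 5 - i) = i := by omega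
  have hj : ((p - 5 - i : ℕ) : ZMod p) = -5 - i := by
    rw [Nat.cast_sub (by omega), Nat.cast_sub (by omega), CharP.cast_eq_zero]
    push_cast
    ring
  simp only [e, e', hj]
  linear_combination w i * w (p - 5 - i) * hf i

end

/-! ### Solving for the ten values in weight 6 -/

section

variable {p : ℕ} [Fact p.Prime]

/-- The values of the triple harmonic sums of weight `6` modulo `p`, in terms of
`b = B_{p-3} / 3`. -/
theorem harmonicThree_weight_six (hp : 11 ≤ p) {b : ZMod p}
    (hb : 3 * b = ((bernoulli (p - 3) : ℚ) : ZMod p)) :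
    harmonicThree p p 1 3 2 = -9 / 2 * b ^ 2 ∧ harmonicThree p p 1 4 1 = 3 * b ^ 2 ∧
    harmonicThree p p 1 1 4 = -3 / 2 * b ^ 2 ∧ harmonicThree p p 2 1 3 = 3 / 2 * b ^ 2 ∧
    harmonicThree p p 2 3 1 = -9 / 2 * b ^ 2 ∧ harmonicThree p p 3 1 2 = 3 / 2 * b ^ 2 ∧
    harmonicThree p p 3 2 1 = 3 * b ^ 2 ∧ harmonicThree p p 4 1 1 = -3 / 2 * b ^ 2 ∧
    harmonicThree p p 1 2 3 = 3 * b ^ 2 ∧ harmonicThree p p 2 2 2 = 0 := by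
  have h2 : (2 : ZMod p) ≠ 0 := by
    exact_mod_cast natCast_zmod_ne_zero (p := p) (n := 2) (by omega) (by omega)
  have h3 : (3 : ZMod p) ≠ 0 := by
    exact_mod_cast natCast_zmod_ne_zero (p := p) (n := 3) (by omega) (by omega)
  let w : ℕ → ZMod p := fun i => ((bernoulli i : ℚ) : ZMod p)
  obtain ⟨W, hW⟩ : ∃ W, W = ∑ i ∈ Finset.range (p - 4), w i * w (p - 5 - i) := ⟨_, rfl⟩
  obtain ⟨V, hV⟩ : ∃ V, V = ∑ i ∈ Finset.range (p - 4),
    w i * w (p - 5 - i) * ((i : ZMod p) * (-5 - i)) := ⟨_, rfl⟩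
  have key : ∀ {a c : ℕ} (A B : ZMod p), (∀ x : ZMod p,
      shiftedRising a x * shiftedRising c (-5 - x) + shiftedRising a (-5 - x) *
        shiftedRising c (-5 - (-5 - x)) = 2 * (A + B * (x * (-5 - x)))) →
      ∀ e, 0 < a → 0 < e → 0 < c → a + e + c = 6 →
      (a.factorial : ZMod p) * c.factorial * harmonicThree p p a e c =
        A * W + B * V + if a ≤ 2 ∧ c ≤ 2 then (3 * b) ^ 2 *
          (shiftedRising a (-3 : ZMod p) * shiftedRising c (-3 : ZMod p)) else 0 := by
    intro a c A B hf e ha he hc hw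
    rw [factorial_mul_harmonicThree ha he hc hw hp, hb, hW, hV,
      ← sum_convolution_symm (by omega) w _ A B h2 hf]
  -- In each case A and B come from averaging the weight over x ↔ -5 - x; here (x+1)(y+1) = xy - 4
  -- when x + y = -5.
  have h222 := key (a := 2) (c := 2) (-4) 1 (by
    intro x; simp [shiftedRising]; ring) 2 (by norm_num) (by norm_num) (by norm_num) rfl
  have h141 := key (a := 1) (c := 1) 1 0 (by
    intro x; simp [shiftedRising]; ring) 4 (by norm_num) (by norm_num) (by norm_num) rfl
  have h114 := key (a := 1) (c := 4) (-9) (3 / 2) (by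
    intro x; simp [shiftedRising, Finset.prod_range_succ]; field_simp; ring) 1 (by norm_num)
    (by norm_num) (by norm_num) rfl
  have h411 := key (a := 4) (c := 1) (-9) (3 / 2) (by
    intro x; simp [shiftedRising, Finset.prod_range_succ]; field_simp; ring) 1 (by norm_num)
    (by norm_num) (by norm_num) rfl
  have h132 := key (a := 1) (c := 2) (-3 / 2) 0 (by
    intro x; simp [shiftedRising]; field_simp; ring) 3 (by norm_num)
    (by norm_num) (by norm_num) rfl
  have h231 := key (a := 2) (c := 1) (-3 / 2) 0 (by
    intro x; simp [shiftedRising]; field_simp; ring) 3 (by norm_num)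
    (by norm_num) (by norm_num) rfl
  have h123 := key (a := 1) (c := 3) 7 (-1) (by
    intro x; simp [shiftedRising, Finset.prod_range_succ]; ring) 2 (by norm_num)
    (by norm_num) (by norm_num) rfl
  have h321 := key (a := 3) (c := 1) 7 (-1) (by
    intro x; simp [shiftedRising, Finset.prod_range_succ]; ring) 2 (by norm_num)
    (by norm_num) (by norm_num) rfl
  have h213 := key (a := 2) (c := 3) 2 (-1 / 2) (by
    intro x; simp [shiftedRising, Finset.prod_range_succ]; field_simp; ring) 1 (by norm_num)
    (by norm_num) (by norm_num) rfl
  have h312 := key (a := 3) (c := 2) 2 (-1 / 2) (by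
    intro x; simp [shiftedRising, Finset.prod_range_succ]; field_simp; ring) 1 (by norm_num)
    (by norm_num) (by norm_num) rfl
  -- Both products vanish, as do the double sums of weight 6; what remains is 3H(2,2,2) = 0 and
  -- 2H(1,1,4) + H(1,4,1) = 0.
  have s222 := harmonicOne_mul_harmonicTwo (p := p) 2 2 2
  have s114 := harmonicOne_mul_harmonicTwo (p := p) 1 1 4
  rw [harmonicOne_eq_zero (by norm_num) (by omega), zero_mul,
    harmonicTwo_eq_zero (by norm_num) (by decide) (by omega) (by norm_num),
    harmonicTwo_eq_zero (by norm_num) (by decide) (by omega) (by norm_num)] at s222 s114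
  norm_num [shiftedRising, Finset.prod_range_succ, Nat.factorial]
    at h222 h141 h114 h411 h132 h231 h123 h321 h213 h312
  have z222 : harmonicThree p p 2 2 2 = 0 := by
    apply mul_left_cancel₀ h3
    linear_combination -s222
  have hne : ∀ n : ℕ, n ∣ 72 → (n : ZMod p) ≠ 0 := by
    have h72 : ((72 : ℕ) : ZMod p) ≠ 0 := by
      rw [show ((72 : ℕ) : ZMod p) = 2 ^ 3 * 3 ^ 2 by norm_num]
      exact mul_ne_zero (pow_ne_zero _ h2) (pow_ne_zero _ h3)
    rintro n ⟨m, hm⟩ h0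
    rw [hm, Nat.cast_mul, h0, zero_mul] at h72
    exact h72 rfl
  have hVW : V = 4 * W - 36 * b ^ 2 := by
    rw [z222] at h222
    linear_combination -h222
  rw [hVW] at h114 h411 h123 h321 h213 h312
  -- Scaling the second relation by 4! = 24 and inserting the formulas for H(1,1,4), H(1,4,1) and V
  -- gives 18W + 108b² = 0.
  have hW' : W = -6 * b ^ 2 := by
    apply mul_left_cancel₀ (hne 18 (by norm_num))
    have h32 : (3 / 2 : ZMod p) * 2 = 3 := div_mul_cancel₀ _ h2
    push_cast
    linear_combination -24 * s114 - 2 * h114 - 24 * h141 + (-4 * W + 36 * b ^ 2) * h32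
  rw [hW'] at h141 h114 h411 h132 h231 h123 h321 h213 h312
  have h6 := hne 6 (by norm_num)
  have h12 := hne 12 (by norm_num)
  have h24 := hne 24 (by norm_num)
  push_cast at h6 h12 h24
  refine ⟨?_, ?_, ?_, ?_, ?_, ?_, ?_, ?_, ?_, z222⟩
  · apply mul_left_cancel₀ h2
    rw [h132]; field_simp; ring
  · rw [h141]; ring
  · apply mul_left_cancel₀ h24
    rw [h114]; field_simp; ring
  · apply mul_left_cancel₀ h12
    rw [h213]; field_simp; ring
  · apply mul_left_cancel₀ h2
    rw [h231]; field_simp; ring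
  · apply mul_left_cancel₀ h12
    rw [h312]; field_simp; ring
  · apply mul_left_cancel₀ h6
    rw [h321]; ring
  · apply mul_left_cancel₀ h24
    rw [h411]; field_simp; ring
  · apply mul_left_cancel₀ h6
    rw [h123]; ring

end

/-! ### Passage to the ring 𝒜_1 -/

theorem sum_piFinset_fin_three {α M : Type*} [AddCommMonoid M] (S : Finset α)
    (F : (Fin 3 → α) → M) :
    ∑ k ∈ Fintype.piFinset (fun _ : Fin 3 => S), F k =
      ∑ x ∈ S, ∑ y ∈ S, ∑ z ∈ S, F ![x, y, z] := by
  simp only [← Finset.sum_product']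
  symm
  refine Finset.sum_bij' (fun t _ => ![t.1, t.2.1, t.2.2]) (fun k _ => (k 0, k 1, k 2))
    ?_ ?_ ?_ ?_ ?_
  · intro t ht
    simp only [Finset.mem_product] at ht
    simp [Fin.forall_fin_succ, ht]
  · intro k hk
    rw [Fintype.mem_piFinset] at hk
    simp [hk]
  · simp
  · intro k _
    ext i
    fin_cases i <;> rfl
  · simp

theorem fmzv_component_eq (n p : ℕ) (s : Fin 3 → ℕ+) :
    (∑ k ∈ Fintype.piFinset (fun _ : Fin 3 => Finset.Ico 1 p) with
        ∀ i j : Fin 3, i < j → k j < k i, ∏ j, ((k j : ZMod n) ^ (s j : ℕ))⁻¹) =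
      harmonicThree n p (s 0) (s 1) (s 2) := by
  rw [Finset.sum_filter, sum_piFinset_fin_three, harmonicThree]
  refine Finset.sum_congr rfl fun x _ => Finset.sum_congr rfl fun y _ =>
    Finset.sum_congr rfl fun z _ => if_congr ?_ ?_ rfl
  · simp [Fin.forall_fin_succ]
    omega
  · simp [Fin.prod_univ_three, invPow]

theorem fmzvStar_component_eq (n p : ℕ) (s : Fin 3 → ℕ+) :
    (∑ k ∈ Fintype.piFinset (fun _ : Fin 3 => Finset.Ico 1 p) with
        ∀ i j : Fin 3, i < j → k j ≤ k i, ∏ j, ((k j : ZMod n) ^ (s j : ℕ))⁻¹) =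
      harmonicStarThree n p (s 0) (s 1) (s 2) := by
  rw [Finset.sum_filter, sum_piFinset_fin_three, harmonicStarThree]
  refine Finset.sum_congr rfl fun x _ => Finset.sum_congr rfl fun y _ =>
    Finset.sum_congr rfl fun z _ => if_congr ?_ ?_ rfl
  · simp [Fin.forall_fin_succ]
    omega
  · simp [Fin.prod_univ_three, invPow]

theorem AdeleLike.mk_eq_mk_of_forall_le {ℓ : ℕ} {a b : ∀ p : Nat.Primes, ZMod ((p : ℕ) ^ ℓ)} (N : ℕ)
    (h : ∀ p : Nat.Primes, N ≤ (p : ℕ) → a p = b p) : AdeleLike.mk ℓ a = AdeleLike.mk ℓ b := by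
  rw [AdeleLike.mk, AdeleLike.mk, Ideal.Quotient.eq]
  change {p : Nat.Primes | (a - b) p ≠ 0}.Finite
  refine Set.Finite.subset
    ((Set.finite_lt_nat N).preimage (f := fun p : Nat.Primes => (p : ℕ))
      Nat.Primes.coe_nat_injective.injOn) fun p hp => ?_
  by_contra hN
  refine hp ?_
  rw [Pi.sub_apply, h p (not_lt.1 hN), sub_self]

/-- Reduction of a rational number modulo a prime is the cast to the prime field. -/
theorem ratModPrimePow_one_eq {p : ℕ} [Fact p.Prime] (r : ℚ) :
    ratModPrimePow p 1 r = (r.num : ZMod (p ^ 1)) * (r.den : ZMod (p ^ 1))⁻¹ := by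
  rw [ratModPrimePow]
  generalize hn : p ^ 1 = n
  rw [pow_one] at hn
  subst hn
  split_ifs with h
  · have hd : (r.den : ZMod p) = 0 := by
      rw [ZMod.natCast_eq_zero_iff]
      rw [padicValRat] at h
      by_contra hd
      rw [padicValNat.eq_zero_of_not_dvd hd] at h
      omega
    -- If p divides the denominator, the inverse of 0 in `ZMod p` is 0 by convention, so both
    -- branches agree.
    rw [hd, ZMod.inv_zero, mul_zero]
  · rfl

theorem bernoulli_div_three_zmod {p : ℕ} [Fact p.Prime] (hp : 5 ≤ p) :
    3 * (((bernoulli (p - 3) / (3 : ℕ) : ℚ)) : ZMod p) = ((bernoulli (p - 3) : ℚ) : ZMod p) := by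
  have h3 : ((3 : ℕ) : ZMod p) ≠ 0 := natCast_zmod_ne_zero (by omega) (by omega)
  have hB := bernoulli_mem_primeToDenSubring (p := p) (p - 3) (by omega)
  have h3' := inv_natCast_mem_primeToDenSubring h3
  have h : ((bernoulli (p - 3) : ℚ) : ZMod p) =
      (((3 : ℕ) * (bernoulli (p - 3) / (3 : ℕ)) : ℚ) : ZMod p) := by
    congr 1
    push_cast
    ring
  rw [h, Rat.cast_mul_of_ne_zero (by simp) (by
    rw [div_eq_mul_inv]
    exact mul_mem hB h3')]
  simp

/-- The values of the triple harmonic sums of weight `6` at the components of `𝒜_1`. -/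
theorem harmonicThree_component {p : ℕ} (hprime : p.Prime) (hp : 11 ≤ p) :
    let b : ZMod (p ^ 1) :=
      if 3 < p then ratModPrimePow p 1 (bernoulli (p - 3) / ((3 : ℕ) : ℚ)) else 0
    harmonicThree (p ^ 1) p 1 3 2 = ratModPrimePow p 1 (-9 / 2) * b ^ 2 ∧
    harmonicThree (p ^ 1) p 1 4 1 = ratModPrimePow p 1 3 * b ^ 2 ∧
    harmonicThree (p ^ 1) p 1 1 4 = ratModPrimePow p 1 (-3 / 2) * b ^ 2 ∧
    harmonicThree (p ^ 1) p 2 1 3 = ratModPrimePow p 1 (3 / 2) * b ^ 2 ∧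
    harmonicThree (p ^ 1) p 2 3 1 = ratModPrimePow p 1 (-9 / 2) * b ^ 2 ∧
    harmonicThree (p ^ 1) p 3 1 2 = ratModPrimePow p 1 (3 / 2) * b ^ 2 ∧
    harmonicThree (p ^ 1) p 3 2 1 = ratModPrimePow p 1 3 * b ^ 2 ∧
    harmonicThree (p ^ 1) p 4 1 1 = ratModPrimePow p 1 (-3 / 2) * b ^ 2 ∧
    harmonicThree (p ^ 1) p 1 2 3 = ratModPrimePow p 1 3 * b ^ 2 ∧
    harmonicThree (p ^ 1) p 2 2 2 = 0 := by
  have : Fact p.Prime := ⟨hprime⟩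
  intro b
  have e1 : (-9 / 2 : ℚ).num = -9 ∧ (-9 / 2 : ℚ).den = 2 := by constructor <;> norm_num
  have e2 : (-3 / 2 : ℚ).num = -3 ∧ (-3 / 2 : ℚ).den = 2 := by constructor <;> norm_num
  have e3 : (3 / 2 : ℚ).num = 3 ∧ (3 / 2 : ℚ).den = 2 := by constructor <;> norm_num
  simp only [b, if_pos (show 3 < p by omega), ratModPrimePow_one_eq, e1, e2, e3]
  clear b
  -- The modulus p ^ 1 is turned into p itself, where the field structure is available.
  generalize hn : p ^ 1 = n
  rw [pow_one] at hn
  subst hn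
  have h := harmonicThree_weight_six hp (bernoulli_div_three_zmod (by omega))
  simp only [Rat.cast_def, div_eq_mul_inv] at h ⊢
  simpa using h

/-- Splitting each ≥ into > or = adds only double and single sums of weight 6, all zero; 11 is the
first prime with 6 < p - 1. -/
theorem harmonicStarThree_eq_harmonicThree {p : ℕ} (hprime : p.Prime) (hp : 11 ≤ p) (n : ℕ)
    (hn : n = p) {a b c : ℕ} (h0 : 0 < a) (h1 : 0 < b) (h2 : 0 < c) (hw : a + b + c = 6) :
    harmonicStarThree n p a b c = harmonicThree n p a b c := by
  have : Fact p.Prime := ⟨hprime⟩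
  subst hn
  rw [harmonicStarThree_eq, harmonicTwo_eq_zero (by omega) (by rw [hw]; decide) (by omega) h2,
    harmonicTwo_eq_zero h0 (by rw [← add_assoc, hw]; decide) (by omega) (by omega),
    harmonicOne_eq_zero (by omega) (by omega), add_zero, add_zero, add_zero]

theorem AdeleLike.mk_mul_mk_sq {ℓ : ℕ} (a b : ∀ p : Nat.Primes, ZMod ((p : ℕ) ^ ℓ)) :
    AdeleLike.mk ℓ a * AdeleLike.mk ℓ b ^ 2 = AdeleLike.mk ℓ fun p => a p * b p ^ 2 := by
  simp only [AdeleLike.mk, ← map_pow, ← map_mul]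
  rfl

theorem fmzv_eq_of_forall {s : Fin 3 → ℕ+} {r : ℚ}
    (h : ∀ p : Nat.Primes, 11 ≤ (p : ℕ) → harmonicThree ((p : ℕ) ^ 1) p (s 0) (s 1) (s 2) =
      ratModPrimePow p 1 r * (if 3 < (p : ℕ) then
        ratModPrimePow p 1 (bernoulli ((p : ℕ) - 3) / ((3 : ℕ) : ℚ)) else 0) ^ 2) :
    fmzv 1 s = ratToAdeleLike 1 r * bernoulliA1 3 ^ 2 := by
  rw [fmzv, ratToAdeleLike, bernoulliA1, AdeleLike.mk_mul_mk_sq]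
  refine AdeleLike.mk_eq_mk_of_forall_le 11 fun p hp => ?_
  rw [fmzv_component_eq]
  exact h p hp

theorem compWeight_fin_three_eq_six {s : Fin 3 → ℕ+} (h : compWeight s = 6) :
    s = ![1, 3, 2] ∨ s = ![1, 4, 1] ∨ s = ![1, 1, 4] ∨ s = ![2, 1, 3] ∨ s = ![2, 3, 1] ∨
    s = ![3, 1, 2] ∨ s = ![3, 2, 1] ∨ s = ![4, 1, 1] ∨ s = ![1, 2, 3] ∨ s = ![2, 2, 2] := by
  rw [compWeight, Fin.sum_univ_three] at h
  have h0 := (s 0).pos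
  have h1 := (s 1).pos
  have h2 := (s 2).pos
  have key : ∀ a b c : ℕ+, (s 0 : ℕ) = a → (s 1 : ℕ) = b → (s 2 : ℕ) = c → s = ![a, b, c] := by
    intro a b c ha hb hc
    ext i
    fin_cases i
    · exact PNat.eq ha
    · exact PNat.eq hb
    · exact PNat.eq hc
  have b0 : (s 0 : ℕ) ≤ 4 := by omega
  have b1 : (s 1 : ℕ) ≤ 4 := by omega
  have e2 : (s 2 : ℕ) = 6 - s 0 - s 1 := by omega
  generalize hx : (s 0 : ℕ) = x at *
  generalize hy : (s 1 : ℕ) = y at *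
  generalize hz : (s 2 : ℕ) = z at *
  interval_cases x <;> interval_cases y <;> first
    | omega
    | subst e2
      rw [key _ _ _ (PNat.mk_coe _ (by norm_num)).symm (PNat.mk_coe _ (by norm_num)).symm
        (PNat.mk_coe _ (by norm_num)).symm]
      decide

theorem mainTheorem7 :
    (∀ s : Fin 3 → ℕ+, compWeight s = 6 →
      ∃ r : ℚ, fmzv 1 s = ratToAdeleLike 1 r * bernoulliA1 3 ^ 2) ∧
    (fmzv 1 ![1, 3, 2] = ratToAdeleLike 1 (-9 / 2) * bernoulliA1 3 ^ 2 ∧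
     fmzv 1 ![1, 4, 1] = ratToAdeleLike 1 3 * bernoulliA1 3 ^ 2 ∧
     fmzv 1 ![1, 1, 4] = ratToAdeleLike 1 (-3 / 2) * bernoulliA1 3 ^ 2 ∧
     fmzv 1 ![2, 1, 3] = ratToAdeleLike 1 (3 / 2) * bernoulliA1 3 ^ 2 ∧
     fmzv 1 ![2, 3, 1] = ratToAdeleLike 1 (-9 / 2) * bernoulliA1 3 ^ 2 ∧
     fmzv 1 ![3, 1, 2] = ratToAdeleLike 1 (3 / 2) * bernoulliA1 3 ^ 2 ∧
     fmzv 1 ![3, 2, 1] = ratToAdeleLike 1 3 * bernoulliA1 3 ^ 2 ∧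
     fmzv 1 ![4, 1, 1] = ratToAdeleLike 1 (-3 / 2) * bernoulliA1 3 ^ 2 ∧
     fmzv 1 ![1, 2, 3] = ratToAdeleLike 1 3 * bernoulliA1 3 ^ 2 ∧
     fmzv 1 ![2, 2, 2] = 0) ∧
    (∀ s : Fin 3 → ℕ+, compWeight s = 6 →
      (compWeight s ≡ compDepth s [MOD 2] → fmzvStar 1 s = -fmzv 1 s) ∧
      (¬ compWeight s ≡ compDepth s [MOD 2] → fmzvStar 1 s = fmzv 1 s)) := by
  have hc := fun p : Nat.Primes => harmonicThree_component p.2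
  have h132 := fmzv_eq_of_forall (s := ![1, 3, 2]) fun p hp => (hc p hp).1
  have h141 := fmzv_eq_of_forall (s := ![1, 4, 1]) fun p hp => (hc p hp).2.1
  have h114 := fmzv_eq_of_forall (s := ![1, 1, 4]) fun p hp => (hc p hp).2.2.1
  have h213 := fmzv_eq_of_forall (s := ![2, 1, 3]) fun p hp => (hc p hp).2.2.2.1
  have h231 := fmzv_eq_of_forall (s := ![2, 3, 1]) fun p hp => (hc p hp).2.2.2.2.1
  have h312 := fmzv_eq_of_forall (s := ![3, 1, 2]) fun p hp => (hc p hp).2.2.2.2.2.1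
  have h321 := fmzv_eq_of_forall (s := ![3, 2, 1]) fun p hp => (hc p hp).2.2.2.2.2.2.1
  have h411 := fmzv_eq_of_forall (s := ![4, 1, 1]) fun p hp => (hc p hp).2.2.2.2.2.2.2.1
  have h123 := fmzv_eq_of_forall (s := ![1, 2, 3]) fun p hp => (hc p hp).2.2.2.2.2.2.2.2.1
  have h222 := fmzv_eq_of_forall (s := ![2, 2, 2]) (r := 0) fun p hp =>
    ((hc p hp).2.2.2.2.2.2.2.2.2).trans (by simp [ratModPrimePow])
  have hr0 : ratToAdeleLike 1 0 = 0 := by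
    rw [ratToAdeleLike, AdeleLike.mk, ← map_zero (Ideal.Quotient.mk (finiteSupportIdeal 1))]
    congr 1
    ext p
    simp [ratModPrimePow]
  refine ⟨?_, ⟨h132, h141, h114, h213, h231, h312, h321, h411, h123, ?_⟩, ?_⟩
  · intro s hs
    rcases compWeight_fin_three_eq_six hs with
      rfl | rfl | rfl | rfl | rfl | rfl | rfl | rfl | rfl | rfl
    exacts [⟨_, h132⟩, ⟨_, h141⟩, ⟨_, h114⟩, ⟨_, h213⟩, ⟨_, h231⟩, ⟨_, h312⟩, ⟨_, h321⟩,
      ⟨_, h411⟩, ⟨_, h123⟩, ⟨_, h222⟩]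
  · rw [h222, hr0, zero_mul]
  · intro s hs
    refine ⟨fun h => ?_, fun _ => ?_⟩
    -- The equal-parity case is vacuous, since 6 and 3 differ modulo 2.
    · rw [hs] at h
      exact absurd h (by simp [compDepth, Nat.ModEq])
    · rw [fmzvStar, fmzv]
      refine AdeleLike.mk_eq_mk_of_forall_le 11 fun p hp => ?_
      rw [fmzv_component_eq, fmzvStar_component_eq]
      refine harmonicStarThree_eq_harmonicThree p.2 hp _ (pow_one _) (s 0).pos (s 1).pos
        (s 2).pos ?_
      rw [← hs, compWeight, Fin.sum_univ_three]
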